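/- Let $k\ge 0$ be an integer, let $\Upsilon$ be a real vector space, and write $\mathbf 0=(0,0)\in\mathbb R^k\times\Upsilon$. For $n\in\mathbb N$ let $\mathcal E^{(n)}=\big(\mathcal X^{(n)},\mathcal B^{(n)},\{\mathbb P^{(n)}_{\tau,\eta}:(\tau,\eta)\in\mathbb R^k\times\Upsilon\}\big)$ be statistical experiments (families of probability measures), and let $\mathcal E=\big(\mathcal X,\mathcal B,\{\mathbb P_{\tau,\eta}:(\tau,\eta)\in\mathbb R^k\times\Upsilon\}\big)$ be an experiment such that $\mathcal B$ is countably generated and $\mathbb P_{\tau,\eta}\ll\mathbb P_{0,0}$ for all $(\tau,\eta)$. Write $d\mathbb P/d\mathbb Q$ for the Radon–Nikodym derivative of the part of $\mathbb P$ that is absolutely continuous with respect to $\mathbb Q$. Assume that $\mathcal E^{(n)}$ converges to $\mathcal E$ in the Le Cam sense: for every finite set $J\subset\mathbb R^k\times\Upsilon$, the law of $\big(d\mathbb P^{(n)}_{t}/d\mathbb P^{(n)}_{0,0}\big)_{t\in J}$ under $\mathbb P^{(n)}_{0,0}$ converges weakly to the law of $\big(d\mathbb P_{t}/d\mathbb P_{0,0}\big)_{t\in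 J}$ under $\mathbb P_{0,0}$. Definitions. For a family $\{P_\eta\}$ on a measurable space $(\Omega,\mathcal A)$, a sub-$\sigma$-field $\mathcal A_0\subseteq\mathcal A$ is *sufficient* if every $A\in\mathcal A$ has an $\mathcal A_0$-measurable version of $P_\eta(A\mid\mathcal A_0)$ common to all $\eta$; *minimal sufficient* if it is sufficient and, for every sufficient $\mathcal A_1$ and every $S\in\mathcal A_0$, there is $S'\in\mathcal A_1$ with $P_\eta(S\triangle S')=0$ for all $\eta$; *boundedly complete* if every bounded $\mathcal A_0$-measurable $\zeta$ with $\int\zeta\,dP_\eta=0$ for all $\eta$ satisfies $\zeta=0$ $P_\eta$-a.s. for all $\eta$; *ancillary* if $P_\eta(A)$ does not depend on $\eta$ for each $A\in\mathcal A_0$; *maximal ancillary* if it is ancillary and not strictly contained in another ancillary sub-$\sigma$-field (it then contains all sets that are null for every $P_\eta$). The *nuisance subexperiments* $\mathcal E^{(n)}_{\mathbf 0}$ and $\mathcal E_{\mathbf 0}$ are the families $\{\mathbb P^{(n)}_{0,\eta}:\eta\in\Upsilon\}$ and $\{\mathbb P_{0,\eta}:\eta\in\Upsilon\}$. Sub-$\sigma$-fields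 $\mathcal A^{(n)}\subseteq\mathcal B^{(n)}$ *converge $\mathcal E^{(n)}$-weakly* to $\mathcal A\subseteq\mathcal B$ if for every $\mathcal A$-measurable real variable $\xi$ there are $\mathcal A^{(n)}$-measurable real variables $\xi_n$ such that, for every finite $J\subset\mathbb R^k\times\Upsilon$, the law of $\big((d\mathbb P^{(n)}_{t}/d\mathbb P^{(n)}_{0,0})_{t\in J},\xi_n\big)$ under $\mathbb P^{(n)}_{0,0}$ converges weakly to the law of $\big((d\mathbb P_{t}/d\mathbb P_{0,0})_{t\in J},\xi\big)$ under $\mathbb P_{0,0}$. Theorem. Assume that (i) $\mathcal E_{\mathbf 0}$ admits a minimal sufficient and boundedly complete $\sigma$-field $\mathcal F_{\rm suff}$ and a maximal ancillary $\sigma$-field $\mathcal B^\ddagger$ such that $\sigma(\mathcal F_{\rm suff}\cup\mathcal B^\ddagger)=\mathcal B$ (this $\mathcal B^\ddagger$ may, but need not, be the only such $\sigma$-field); (ii) for each $n$, $\mathcal E^{(n)}_{\mathbf 0}$ admits a minimal sufficient and boundedly complete $\sigma$-field $\mathcal F^{(n)}_{\rm suff}$ and a maximal ancillary $\sigma$-field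 $\mathcal B^{\ddagger(n)}$; (iii) $\mathcal B^{\ddagger(n)}$ converges $\mathcal E^{(n)}$-weakly to $\mathcal B^\ddagger$ as $n\to\infty$. Then, for all $l_1,l_2\in\mathbb N$, $\tau_1,\dots,\tau_{l_1}\in\mathbb R^k$ and $\eta_1,\dots,\eta_{l_2}\in\Upsilon$, under $\mathbb P^{(n)}_{0,0}$ as $n\to\infty$, $$\left(\mathbb E^{(n)}_{0,0}\left[\frac{d\mathbb P^{(n)}_{\tau_i,\eta_j}}{d\mathbb P^{(n)}_{0,0}}\,\Big|\,\mathcal B^{\ddagger(n)}\right]\right)_{i\le l_1,\,j\le l_2}\ \xrightarrow{\ \mathcal L\ }\ \left(\mathbb E_{0,0}\left[\frac{d\mathbb P_{\tau_i,\eta_j}}{d\mathbb P_{0,0}}\,\Big|\,\mathcal B^{\ddagger}\right]\right)_{i\le l_1,\,j\le l_2},$$ where the limit vector is taken under $\mathbb P_{0,0}$, and $\mathbb E^{(n)}_{0,0}$, $\mathbb E_{0,0}$ are expectations under $\mathbb P^{(n)}_{0,0}$, $\mathbb P_{0,0}$. -/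

import Mathlib

open MeasureTheory ProbabilityTheory Filter

namespace Ancillarity

/-! A statistical experiment is a family `P : T → Measure Ω` of probability measures on a
measurable space `Ω`. Sub-σ-fields are elements `m : MeasurableSpace Ω` below the ambient one. -/

section SingleExperiment

variable {Ω H : Type*} {mΩ : MeasurableSpace Ω}

/-- `m` is a sufficient sub-σ-field for the family `P`: for every event there is a version of its
conditional probability given `m` that is common to all members of the family. -/
def IsSufficient (P : H → Measure Ω) (m : MeasurableSpace Ω) : Prop :=
  m ≤ mΩ ∧ ∀ A : Set Ω, MeasurableSet[mΩ] A →
    ∃ g : Ω → ℝ, Measurable[m] g ∧ ∀ h, (P h)⟦A | m⟧ =ᵐ[P h] g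

/-- `m` is minimal sufficient: it is sufficient and, up to sets that are null for every member of
the family, it is contained in every sufficient sub-σ-field. -/
def IsMinimalSufficient (P : H → Measure Ω) (m : MeasurableSpace Ω) : Prop :=
  IsSufficient P m ∧ ∀ m' : MeasurableSpace Ω, IsSufficient P m' →
    ∀ s, MeasurableSet[m] s → ∃ s', MeasurableSet[m'] s' ∧ ∀ h, P h (symmDiff s s') = 0

/-- `m` is boundedly complete: a bounded `m`-measurable variable with zero expectation under every
member of the family vanishes almost surely under every member of the family. -/
def IsBoundedlyComplete (P : H → Measure Ω) (m : MeasurableSpace Ω) : Prop :=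
  m ≤ mΩ ∧ ∀ ζ : Ω → ℝ, Measurable[m] ζ → (∃ C : ℝ, ∀ ω, |ζ ω| ≤ C) →
    (∀ h, ∫ ω, ζ ω ∂(P h) = 0) → ∀ h, ζ =ᵐ[P h] 0

/-- `m` is ancillary: the probability of an event of `m` is the same under all members of the
family. -/
def IsAncillary (P : H → Measure Ω) (m : MeasurableSpace Ω) : Prop :=
  m ≤ mΩ ∧ ∀ s, MeasurableSet[m] s → ∀ h h', P h s = P h' s

/-- `m` is maximal ancillary: no ancillary sub-σ-field strictly contains it. Such an `m` contains
every event that is null for all members of the family, because adjoining these events to an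
ancillary σ-field keeps it ancillary. -/
def IsMaximalAncillary (P : H → Measure Ω) (m : MeasurableSpace Ω) : Prop :=
  IsAncillary P m ∧ ∀ m' : MeasurableSpace Ω, IsAncillary P m' → m ≤ m' → m' ≤ m

/-- The likelihood ratio `dP_t / dP_0`: the Radon–Nikodym derivative with respect to `P_0` of the
part of `P_t` that is absolutely continuous with respect to `P_0`. -/
noncomputable def likelihoodRatio {T : Type*} [Zero T] (P : T → Measure Ω) (t : T) (ω : Ω) : ℝ :=
  ((P t).rnDeriv (P 0) ω).toReal

/-- The nuisance subexperiment: the parameter of interest is fixed at zero. -/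
def nuisance {Θ Υ : Type*} [Zero Θ] (P : Θ × Υ → Measure Ω) (η : Υ) : Measure Ω :=
  P (0, η)

end SingleExperiment

section Sequences

variable {T : Type*} [Zero T]
  {X : ℕ → Type*} {mX : ∀ n, MeasurableSpace (X n)}
  {Y : Type*} {mY : MeasurableSpace Y}

/-- Convergence of the experiments `P n` to the experiment `Q` in the Le Cam sense: the
finite-dimensional vectors of likelihood ratios with respect to the parameter value `0` converge
in distribution under that parameter value. -/
def LeCamConverges (P : ∀ n, T → Measure (X n)) [∀ n t, IsProbabilityMeasure (P n t)]
    (Q : T → Measure Y) [∀ t, IsProbabilityMeasure (Q t)] : Prop :=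
  ∀ J : Finset T,
    TendstoInDistribution (fun n x (t : J) => likelihoodRatio (P n) (t : T) x) atTop
      (fun y (t : J) => likelihoodRatio Q (t : T) y) (fun n => P n 0) (Q 0)

/-- Weak convergence, along the experiments `P n`, of the variables `ξs n` to the variable `ξ`:
convergence in distribution jointly with every finite vector of likelihood ratios. -/
def WeaklyConverges (P : ∀ n, T → Measure (X n)) [∀ n t, IsProbabilityMeasure (P n t)]
    (Q : T → Measure Y) [∀ t, IsProbabilityMeasure (Q t)]
    (ξs : ∀ n, X n → ℝ) (ξ : Y → ℝ) : Prop :=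
  ∀ J : Finset T,
    TendstoInDistribution
      (fun n x => ((fun t : J => likelihoodRatio (P n) (t : T) x), ξs n x)) atTop
      (fun y => ((fun t : J => likelihoodRatio Q (t : T) y), ξ y)) (fun n => P n 0) (Q 0)

/-- Weak convergence, along the experiments `P n`, of the sub-σ-fields `A n` to the sub-σ-field
`B`: every `B`-measurable variable is the weak limit of a sequence of `A n`-measurable ones. -/
def SigmaFieldWeaklyConverges (P : ∀ n, T → Measure (X n))
    [∀ n t, IsProbabilityMeasure (P n t)]
    (Q : T → Measure Y) [∀ t, IsProbabilityMeasure (Q t)]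
    (A : ∀ n, MeasurableSpace (X n)) (B : MeasurableSpace Y) : Prop :=
  ∀ ξ : Y → ℝ, Measurable[B] ξ →
    ∃ ξs : ∀ n, X n → ℝ, (∀ n, Measurable[A n] (ξs n)) ∧
      WeaklyConverges (mX := mX) P Q ξs ξ

end Sequences

end Ancillarity

/-!
Write `L_t` for the likelihood ratios of the limit experiment, `B` for its ancillary σ-field, `S`
for its sufficient one, and consider the nuisance likelihood ratios `L_{(0, η)}`.

*Independence.* In every experiment, limit or not, the nuisance likelihood ratios are measurable
with respect to the sufficient σ-field up to null sets
(`IsSufficient.exists_measurable_ae_eq_rnDeriv`), and Basu's theorem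
(`IsSufficient.indep_of_isAncillary`) makes that σ-field independent of the ancillary one.
Hence `E[φ((L_{(0, η)})_η) g | B] = E[φ((L_{(0, η)})_η)] g` for `B`-measurable `g`, and likewise
along the sequence.

*Density.* In the limit experiment the nuisance likelihood ratios generate a sufficient σ-field
(`isSufficient_comap_rnDeriv`), so by minimality they generate `S` up to null sets, and together
with `B` they generate the whole σ-field. A π-λ argument then shows that each `L_t` is an
`L¹`-limit of finite sums `∑ φₖ((L_{(0, η)})_η) 1_{Aₖ}` with `φₖ` bounded continuous and `Aₖ ∈ B`
(`exists_sum_rectangleTerm_integral_abs_sub_le`).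

*Transfer.* The finitely many events occurring in such approximations are encoded by one
`B`-measurable real variable `ξ`, so that `1_{Aₖ} = gₖ(ξ)` with `gₖ` bounded continuous
(`exists_measurable_encoding`), and `ξ` is the weak limit of variables `ξₙ` measurable with respect
to the ancillary σ-fields of the sequence, jointly with the likelihood ratios. The `L¹`-error of
the approximation persists along the sequence because likelihood ratios are nonnegative with mass
at most one, and their limit has mass one
(`eventually_integral_abs_sub_le_of_tendstoInDistribution`). Conditional expectations are
`L¹`-contractions, so with `aₖ = E[φₖ((L_{(0, η)})_η)]` both conditional expectations, in the limit
and along the sequence, are `L¹`-close to `∑ aₖ gₖ(ξ)` and `∑ aₖ gₖ(ξₙ)`. The latter converges in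
distribution to the former by continuous mapping, and the errors are arbitrarily small.
-/

namespace Ancillarity

open scoped ENNReal BoundedContinuousFunction Topology

/-! ### Sufficiency, likelihood ratios and Basu's theorem -/

section SufficiencyAndBasu

variable {Ω H : Type*} {m m₂ mΩ : MeasurableSpace Ω} {P : H → Measure Ω}

theorem measure_inter_eq_setLIntegral_of_condExp {μ : Measure Ω} [IsProbabilityMeasure μ]
    (hm : m ≤ mΩ) {A : Set Ω} (hA : MeasurableSet A) {g : Ω → ℝ} (hg : μ⟦A | m⟧ =ᵐ[μ] g)
    {s : Set Ω} (hs : MeasurableSet[m] s) :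
    μ (A ∩ s) = ∫⁻ ω in s, ENNReal.ofReal (g ω) ∂μ := by
  have hint : Integrable (A.indicator fun _ => (1 : ℝ)) μ := (integrable_const _).indicator hA
  have h0 : 0 ≤ᵐ[μ] μ⟦A | m⟧ :=
    condExp_nonneg (.of_forall fun ω => Set.indicator_nonneg (fun _ _ => zero_le_one) ω)
  have h1 : ∫⁻ ω in s, ENNReal.ofReal (g ω) ∂μ = ∫⁻ ω in s, ENNReal.ofReal ((μ⟦A | m⟧) ω) ∂μ :=
    lintegral_congr_ae (ae_restrict_of_ae (hg.mono fun ω h => by simp only [h]))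
  rw [h1, ← ofReal_integral_eq_lintegral_ofReal integrable_condExp.integrableOn
    (ae_restrict_of_ae h0), setIntegral_condExp hm hint hs, integral_indicator hA,
    Measure.restrict_restrict hA]
  simp [measureReal_def]

/-- A version `g` of the conditional probability of `A` given `m` acts as the density of the
restriction of the measure to `A`, as long as only `m`-measurable functions are integrated. -/
theorem setLIntegral_eq_lintegral_mul_condProb {μ : Measure Ω} [IsProbabilityMeasure μ]
    (hm : m ≤ mΩ) {A : Set Ω} (hA : MeasurableSet A) {g : Ω → ℝ} (hgm : Measurable[m] g)
    (hg : μ⟦A | m⟧ =ᵐ[μ] g) {f : Ω → ℝ≥0∞} (hf : Measurable[m] f) :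
    ∫⁻ ω in A, f ω ∂μ = ∫⁻ ω, ENNReal.ofReal (g ω) * f ω ∂μ := by
  have hgm' : Measurable[m] fun ω => ENNReal.ofReal (g ω) := ENNReal.measurable_ofReal.comp hgm
  have key : (μ.restrict A).trim hm = (μ.trim hm).withDensity fun ω => ENNReal.ofReal (g ω) := by
    refine @Measure.ext _ m _ _ fun s hs => ?_
    rw [trim_measurableSet_eq hm hs, withDensity_apply _ hs, setLIntegral_trim hm hgm' hs,
      Measure.restrict_apply (hm s hs), Set.inter_comm,
      measure_inter_eq_setLIntegral_of_condExp hm hA hg hs]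
  rw [← lintegral_trim hm hf, key, lintegral_withDensity_eq_lintegral_mul _ hgm' hf,
    lintegral_trim hm (hgm'.mul hf)]
  rfl

/-- The easy direction of the factorization theorem, without domination: the likelihood ratio of
two members of the family is measurable, up to a null set, with respect to any sufficient
σ-field. It is the likelihood ratio of the restrictions of the two measures to that σ-field. -/
theorem IsSufficient.exists_measurable_ae_eq_rnDeriv [∀ h, IsProbabilityMeasure (P h)]
    (hs : IsSufficient P m) (h₀ h : H) :
    ∃ f : Ω → ℝ, Measurable[m] f ∧ (fun ω => ((P h).rnDeriv (P h₀) ω).toReal) =ᵐ[P h₀] f := by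
  have hm : m ≤ mΩ := hs.1
  set μ' : @Measure Ω m := (P h₀).trim hm with hμ'
  set ν' : @Measure Ω m := (P h).trim hm with hν'
  set f : Ω → ℝ≥0∞ := @Measure.rnDeriv Ω m ν' μ' with hf
  have hfm : Measurable[m] f := @Measure.measurable_rnDeriv Ω m ν' μ'
  have hdec : ν' = @Measure.singularPart Ω m ν' μ' + μ'.withDensity f :=
    @Measure.haveLebesgueDecomposition_add Ω m ν' μ' _
  -- `N ∈ m` carries the absolutely continuous part; `Nᶜ` is null for `P h₀`, so it carries the
  -- singular part, of the traces on `m` and, as is shown here, of the measures themselves.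
  obtain ⟨N, hN, hN0, hN1⟩ := @Measure.mutuallySingular_singularPart Ω m ν' μ'
  have hNμ : P h₀ Nᶜ = 0 := by rwa [hμ', trim_measurableSet_eq hm hN.compl] at hN1
  refine ⟨fun ω => (f ω).toReal, hfm.ennreal_toReal, ?_⟩
  suffices H : f =ᵐ[P h₀] (P h).rnDeriv (P h₀) from H.symm.mono fun ω hω => by simp only [hω]
  refine Measure.eq_rnDeriv (s := (P h).restrict Nᶜ) (hfm.mono hm le_rfl)
    ⟨N, hm N hN, ?_, hNμ⟩ ?_
  · rw [Measure.restrict_apply (hm N hN), Set.inter_compl_self, measure_empty]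
  ext A hA
  obtain ⟨g, hgm, hg⟩ := hs.2 A hA
  have hgm' : Measurable[m] fun ω => ENNReal.ofReal (g ω) := ENNReal.measurable_ofReal.comp hgm
  have h1 : (P h) (A ∩ N) = ∫⁻ ω in A, f ω ∂(P h₀) := by
    rw [measure_inter_eq_setLIntegral_of_condExp hm hA (hg h) hN,
      setLIntegral_eq_lintegral_mul_condProb hm hA hgm (hg h₀) hfm,
      ← setLIntegral_trim hm hgm' hN]
    have hr : ν'.restrict N = (μ'.withDensity f).restrict N := by
      conv_lhs => rw [hdec]
      rw [Measure.restrict_add, Measure.restrict_eq_zero.2 hN0, zero_add]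
    rw [← hν', hr, restrict_withDensity hN, lintegral_withDensity_eq_lintegral_mul _ hfm hgm',
      Measure.restrict_eq_self_of_ae_mem (measure_eq_zero_iff_ae_notMem.1 hN1 |>.mono
        fun ω hω => not_not.1 hω)]
    rw [hμ', lintegral_trim hm (hfm.mul hgm')]
    exact lintegral_congr fun ω => mul_comm _ _
  rw [Measure.add_apply, Measure.restrict_apply hA, withDensity_apply _ hA, ← h1, add_comm,
    ← Set.sdiff_eq, measure_inter_add_sdiff _ (hm N hN)]

/-- **Basu's theorem**: a boundedly complete sufficient σ-field is independent of every ancillary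
σ-field. -/
theorem IsSufficient.indep_of_isAncillary [∀ h, IsProbabilityMeasure (P h)]
    (hs : IsSufficient P m) (hc : IsBoundedlyComplete P m) (hB : IsAncillary P m₂) (h : H) :
    Indep m m₂ (P h) := by
  have hm : m ≤ mΩ := hs.1
  rw [Indep_iff]
  intro s b hsm hbm
  obtain ⟨g, hgm, hg⟩ := hs.2 b (hB.1 b hbm)
  have hbΩ := hB.1 b hbm
  -- Completeness applies to bounded variables only, so the version `g` is clipped to `[0, 1]`.
  let g' : Ω → ℝ := fun ω => max 0 (min (g ω) 1)
  have hg'm : Measurable[m] g' := measurable_const.max (hgm.min measurable_const)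
  have hint : ∀ h', Integrable (b.indicator fun _ => (1 : ℝ)) (P h') :=
    fun h' => (integrable_const _).indicator hbΩ
  have hg' : ∀ h', (P h')⟦b | m⟧ =ᵐ[P h'] g' := by
    intro h'
    have h0 : 0 ≤ᵐ[P h'] (P h')⟦b | m⟧ :=
      condExp_nonneg (.of_forall fun ω => Set.indicator_nonneg (fun _ _ => zero_le_one) ω)
    have h1 : (P h')⟦b | m⟧ ≤ᵐ[P h'] fun _ => (1 : ℝ) := by
      have := condExp_mono (m := m) (hint h') (integrable_const (1 : ℝ))
        (.of_forall fun ω => Set.indicator_le_self' (fun _ _ => zero_le_one) ω)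
      rwa [condExp_const hm] at this
    filter_upwards [h0, h1, hg h'] with ω a0 a1 a2
    rw [a2] at a0 a1 ⊢
    simp only [g', min_eq_left a1]
    exact (max_eq_right a0).symm
  have hzero := hc.2 (fun ω => g' ω - (P h).real b) (hg'm.sub measurable_const)
    ⟨1, fun ω => by
      have h1 : 0 ≤ g' ω := le_max_left _ _
      have h2 : g' ω ≤ 1 := max_le zero_le_one (min_le_right _ _)
      have h3 : (P h).real b ≤ 1 := measureReal_le_one
      have h4 : 0 ≤ (P h).real b := measureReal_nonneg
      rw [abs_le]; constructor <;> linarith⟩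
    (fun h' => by
      rw [integral_sub (integrable_condExp.congr (hg' h')) (integrable_const _),
        ← integral_congr_ae (hg' h'), integral_condExp hm, integral_indicator hbΩ]
      simp [measureReal_def, hB.2 b hbm h h']) h
  rw [Set.inter_comm, measure_inter_eq_setLIntegral_of_condExp hm hbΩ (hg' h) hsm]
  have : ∫⁻ ω in s, ENNReal.ofReal (g' ω) ∂(P h) = ∫⁻ ω in s, P h b ∂(P h) := by
    refine lintegral_congr_ae (ae_restrict_of_ae (hzero.mono fun ω hω => ?_))
    have : g' ω = (P h).real b := sub_eq_zero.1 hω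
    simp only [this, measureReal_def, ENNReal.ofReal_toReal (measure_ne_top _ _)]
  rw [this, setLIntegral_const, mul_comm]

theorem condExp_eq_const_of_indep {μ : Measure Ω} [IsProbabilityMeasure μ]
    (hm : m ≤ mΩ) (hm₂ : m₂ ≤ mΩ) {f : Ω → ℝ}
    (hf : AEStronglyMeasurable[m] f μ) (h : Indep m m₂ μ) :
    μ[f | m₂] =ᵐ[μ] fun _ => ∫ ω, f ω ∂μ := by
  obtain ⟨g, hg, hfg⟩ := hf
  refine (condExp_congr_ae hfg).trans ((condExp_indep_eq hm hm₂ hg h).trans ?_)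
  rw [integral_congr_ae hfg]

/-- The other direction of the factorization theorem: in a dominated experiment, the σ-field
generated by the likelihood ratios is sufficient. -/
theorem isSufficient_comap_rnDeriv [∀ h, IsProbabilityMeasure (P h)] (h₀ : H)
    (hac : ∀ h, P h ≪ P h₀) :
    IsSufficient P (MeasurableSpace.comap
      (fun ω h => ((P h).rnDeriv (P h₀) ω).toReal) MeasurableSpace.pi) := by
  set L : Ω → H → ℝ := fun ω h => ((P h).rnDeriv (P h₀) ω).toReal with hL
  have hLm : Measurable L :=
    measurable_pi_lambda _ fun h => (Measure.measurable_rnDeriv _ _).ennreal_toReal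
  have hm : MeasurableSpace.comap L MeasurableSpace.pi ≤ mΩ := hLm.comap_le
  refine ⟨hm, fun A hA => ⟨(P h₀)⟦A | MeasurableSpace.comap L MeasurableSpace.pi⟧,
    stronglyMeasurable_condExp.measurable, fun h => ?_⟩⟩
  set m' := MeasurableSpace.comap L MeasurableSpace.pi with hm'
  have hLh : StronglyMeasurable[m'] fun ω => L ω h :=
    ((measurable_pi_apply h).comp (comap_measurable L)).stronglyMeasurable
  have hint : ∀ h', Integrable (A.indicator fun _ => (1 : ℝ)) (P h') :=
    fun h' => (integrable_const _).indicator hA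
  have hLint : Integrable (fun ω => L ω h) (P h₀) := Measure.integrable_toReal_rnDeriv
  have hLAint : Integrable ((fun ω => L ω h) * A.indicator fun _ => (1 : ℝ)) (P h₀) := by
    refine (hLint.indicator hA).congr (.of_forall fun ω => ?_)
    by_cases hω : ω ∈ A <;> simp [hω]
  have hpull := condExp_mul_of_stronglyMeasurable_left hLh hLAint (hint h₀)
  -- Bayes' formula: the version for `P h₀` also serves `P h`, since `L h` is measurable with
  -- respect to the σ-field and can be pulled out.
  have hgint : Integrable ((P h₀)⟦A | m'⟧) (P h) := by
    rw [← integrable_rnDeriv_smul_iff (hac h)]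
    exact (integrable_condExp.congr hpull)
  symm
  refine ae_eq_condExp_of_forall_setIntegral_eq hm (hint h) (fun s _ _ => hgint.integrableOn)
    (fun s hs _ => ?_) stronglyMeasurable_condExp.aestronglyMeasurable
  rw [← setIntegral_rnDeriv_smul (hac h) (hm s hs), ← setIntegral_rnDeriv_smul (hac h) (hm s hs)]
  have h1 := setIntegral_condExp hm hLAint hs
  rw [setIntegral_congr_ae (hm s hs) (hpull.mono fun ω hω _ => hω)] at h1
  exact h1

end SufficiencyAndBasu

/-! ### Density of sums of rectangle terms -/

section Density

/-- A bounded continuous function of finitely many coordinates, times the indicator of an event of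
the σ-field `B`. -/
structure RectangleTerm (H : Type*) {Y : Type*} (B : MeasurableSpace Y) where
  /-- the finitely many coordinates on which the continuous factor depends -/
  coords : Finset H
  /-- the continuous factor -/
  weight : (coords → ℝ) →ᵇ ℝ
  /-- the event in `B` -/
  event : Set Y
  measurableSet_event : MeasurableSet[B] event

variable {Y H : Type*} {B mY : MeasurableSpace Y} {μ : Measure Y} {ℓ : H → Y → ℝ}

/-- The variable that a rectangle term defines once a variable `ℓ h` is substituted for each
coordinate `h`. -/
noncomputable def RectangleTerm.eval (ℓ : H → Y → ℝ) (c : RectangleTerm H B) (y : Y) : ℝ :=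
  c.weight (fun j => ℓ j y) * c.event.indicator (fun _ => 1) y

/-- The linear span of the variables defined by rectangle terms. -/
noncomputable def rectangleSpan (ℓ : H → Y → ℝ) (B : MeasurableSpace Y) : Submodule ℝ (Y → ℝ) :=
  Submodule.span ℝ (Set.range (RectangleTerm.eval (B := B) ℓ))

theorem one_mem_rectangleSpan : (fun _ => 1 : Y → ℝ) ∈ rectangleSpan ℓ B := by
  refine Submodule.subset_span ⟨⟨∅, 1, Set.univ, MeasurableSet.univ⟩, ?_⟩
  ext y
  simp [RectangleTerm.eval]

theorem measurable_of_mem_rectangleSpan (hB : B ≤ mY) (hℓ : ∀ h, Measurable (ℓ h)) {g : Y → ℝ}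
    (hg : g ∈ rectangleSpan ℓ B) : Measurable g := by
  induction hg using Submodule.span_induction with
  | mem x hx =>
    obtain ⟨c, rfl⟩ := hx
    exact (c.weight.continuous.measurable.comp (measurable_pi_lambda _ fun j => hℓ j)).mul
      (measurable_const.indicator (hB _ c.measurableSet_event))
  | zero => exact measurable_const
  | add x y _ _ hx hy => exact hx.add hy
  | smul a x _ hx => exact hx.const_smul a

/-- The indicator of `A` is an `L¹`-limit of linear combinations of rectangle terms. -/
def IsApproxByRectangles (μ : Measure Y) (ℓ : H → Y → ℝ) (B : MeasurableSpace Y) (A : Set Y) :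
    Prop :=
  ∀ ε : ℝ≥0∞, ε ≠ 0 →
    ∃ g ∈ rectangleSpan ℓ B, eLpNorm (g - A.indicator fun _ => (1 : ℝ)) 1 μ ≤ ε

theorem IsApproxByRectangles.of_symmDiff (hB : B ≤ mY) (hℓ : ∀ h, Measurable (ℓ h)) {A : Set Y}
    (hA : MeasurableSet A)
    (h : ∀ ε : ℝ≥0∞, ε ≠ 0 → ∃ A', MeasurableSet A' ∧ IsApproxByRectangles μ ℓ B A' ∧
      μ (symmDiff A' A) ≤ ε) : IsApproxByRectangles μ ℓ B A := by
  intro ε hε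
  obtain ⟨A', hA'm, hA', hle⟩ := h (ε / 2) (by simpa using hε)
  obtain ⟨g, hg, hgle⟩ := hA' (ε / 2) (by simpa using hε)
  refine ⟨g, hg, ?_⟩
  have hgm := measurable_of_mem_rectangleSpan hB hℓ hg
  have h1 : Measurable (A'.indicator fun _ => (1 : ℝ)) := measurable_const.indicator hA'm
  have h2 : Measurable (A.indicator fun _ => (1 : ℝ)) := measurable_const.indicator hA
  calc eLpNorm (g - A.indicator fun _ => (1 : ℝ)) 1 μ
      = eLpNorm ((g - A'.indicator fun _ => (1 : ℝ)) +
          ((A'.indicator fun _ => (1 : ℝ)) - A.indicator fun _ => (1 : ℝ))) 1 μ := by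
        rw [sub_add_sub_cancel]
    _ ≤ _ := eLpNorm_add_le (hgm.sub h1).aestronglyMeasurable (h1.sub h2).aestronglyMeasurable
        le_rfl
    _ ≤ ε / 2 + ε / 2 := by
        refine add_le_add hgle ?_
        rw [eLpNorm_indicator_sub_indicator, eLpNorm_indicator_const
          (hA'm.symmDiff hA) one_ne_zero ENNReal.one_ne_top]
        simpa using hle
    _ = ε := ENNReal.add_halves ε

theorem IsApproxByRectangles.compl {A : Set Y} (h : IsApproxByRectangles μ ℓ B A) :
    IsApproxByRectangles μ ℓ B Aᶜ := by
  intro ε hε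
  obtain ⟨g, hg, hgle⟩ := h ε hε
  refine ⟨(fun _ => 1) - g, Submodule.sub_mem _ one_mem_rectangleSpan hg, ?_⟩
  have : ((fun _ => 1) - g - Aᶜ.indicator fun _ => (1 : ℝ))
      = -(g - A.indicator fun _ => (1 : ℝ)) := by
    ext y
    by_cases hy : y ∈ A <;> simp [hy]
  rwa [this, eLpNorm_neg]

theorem IsApproxByRectangles.union (hB : B ≤ mY) (hℓ : ∀ h, Measurable (ℓ h)) {A A' : Set Y}
    (hA : MeasurableSet A) (hA' : MeasurableSet A') (hd : Disjoint A A')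
    (h : IsApproxByRectangles μ ℓ B A) (h' : IsApproxByRectangles μ ℓ B A') :
    IsApproxByRectangles μ ℓ B (A ∪ A') := by
  intro ε hε
  obtain ⟨g, hg, hgle⟩ := h (ε / 2) (by simpa using hε)
  obtain ⟨g', hg', hgle'⟩ := h' (ε / 2) (by simpa using hε)
  refine ⟨g + g', Submodule.add_mem _ hg hg', ?_⟩
  have h1 : Measurable (A.indicator fun _ => (1 : ℝ)) := measurable_const.indicator hA
  have h2 : Measurable (A'.indicator fun _ => (1 : ℝ)) := measurable_const.indicator hA'
  rw [Set.indicator_union_of_disjoint hd]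
  calc _ = eLpNorm ((g - A.indicator fun _ => (1 : ℝ)) + (g' - A'.indicator fun _ => (1 : ℝ)))
          1 μ := by rw [sub_add_sub_comm]; rfl
    _ ≤ _ := eLpNorm_add_le
        ((measurable_of_mem_rectangleSpan hB hℓ hg).sub h1).aestronglyMeasurable
        ((measurable_of_mem_rectangleSpan hB hℓ hg').sub h2).aestronglyMeasurable le_rfl
    _ ≤ ε / 2 + ε / 2 := add_le_add hgle hgle'
    _ = ε := ENNReal.add_halves ε

theorem IsApproxByRectangles.iUnion [IsFiniteMeasure μ] (hB : B ≤ mY) (hℓ : ∀ h, Measurable (ℓ h))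
    {A : ℕ → Set Y} (hA : ∀ i, MeasurableSet (A i)) (hd : Pairwise (Function.onFun Disjoint A))
    (h : ∀ i, IsApproxByRectangles μ ℓ B (A i)) : IsApproxByRectangles μ ℓ B (⋃ i, A i) := by
  have hmeas : ∀ n, MeasurableSet (partialSups A n) := fun n => by
    rw [partialSups_eq_biUnion_range]
    exact Finset.measurableSet_biUnion _ fun i _ => hA i
  have hfin : ∀ n, IsApproxByRectangles μ ℓ B (partialSups A n) := by
    intro n
    induction n with
    | zero => simpa using h 0
    | succ n ih =>
      rw [partialSups_add_one]
      refine ih.union hB hℓ (hmeas n) (hA _) ?_ (h _)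
      rw [partialSups_eq_biUnion_range, Set.disjoint_iUnion₂_left]
      exact fun i hi => hd (by simp at hi; omega)
  refine .of_symmDiff hB hℓ (.iUnion hA) fun ε hε => ?_
  have hle : ∀ n, (partialSups A n : Set Y) ⊆ ⋃ i, A i := fun n =>
    partialSups_le A n _ fun i _ => Set.subset_iUnion A i
  have hlim : Tendsto (fun n => μ ((⋃ i, A i) \ partialSups A n)) atTop (𝓝 0) := by
    have h1 : Tendsto (fun n => μ (partialSups A n : Set Y)) atTop (𝓝 (μ (⋃ i, A i))) := by
      have := tendsto_measure_iUnion_atTop (μ := μ) (partialSups A).monotone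
      have h2 : (⋃ n, (partialSups A n : Set Y)) = ⋃ i, A i := iSup_partialSups_eq A
      rwa [h2] at this
    have h3 := ENNReal.Tendsto.sub (tendsto_const_nhds (x := μ (⋃ i, A i))) h1
      (.inl (measure_ne_top _ _))
    rw [tsub_self] at h3
    refine h3.congr fun n => ?_
    rw [measure_sdiff (hle n) (hmeas n).nullMeasurableSet (measure_ne_top _ _)]
  obtain ⟨n, hn⟩ := (hlim.eventually_le_const (pos_iff_ne_zero.2 hε)).exists
  refine ⟨_, hmeas n, hfin n, ?_⟩
  rwa [symmDiff_of_le (hle n)]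

theorem isApproxByRectangles_cylinder_inter [IsFiniteMeasure μ] (hℓ : ∀ h, Measurable (ℓ h))
    {C : Set (H → ℝ)} (hC : C ∈ measurableCylinders fun _ : H => ℝ) {b : Set Y}
    (hb : MeasurableSet[B] b) :
    IsApproxByRectangles μ ℓ B ((fun y h => ℓ h y) ⁻¹' C ∩ b) := by
  intro ε hε
  obtain ⟨J, D, hD, rfl⟩ := (mem_measurableCylinders C).1 hC
  have hLm : Measurable fun y (j : J) => ℓ j y := measurable_pi_lambda _ fun j => hℓ j
  obtain ⟨φ, hφ, -⟩ := Integrable.exists_boundedContinuous_lintegral_sub_le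
    (μ := μ.map fun y (j : J) => ℓ j y) (f := D.indicator fun _ => (1 : ℝ))
    ((integrable_const _).indicator hD) hε
  refine ⟨_, Submodule.subset_span ⟨⟨J, φ, b, hb⟩, rfl⟩, ?_⟩
  rw [eLpNorm_one_eq_lintegral_enorm]
  refine le_trans (lintegral_mono fun y => ?_) ((lintegral_map (by
    exact ((measurable_const.indicator hD).sub φ.continuous.measurable).enorm) hLm).symm.trans_le
    hφ)
  by_cases hy : y ∈ b
  · have : ((fun y h => ℓ h y) ⁻¹' cylinder J D ∩ b).indicator (fun _ => (1 : ℝ)) y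
        = D.indicator (fun _ => 1) fun j : J => ℓ j y := by
      by_cases hyD : (fun j : J => ℓ j y) ∈ D
      · rw [Set.indicator_of_mem hyD, Set.indicator_of_mem]
        exact ⟨hyD, hy⟩
      · rw [Set.indicator_of_notMem hyD, Set.indicator_of_notMem]
        exact fun h => hyD h.1
    simp only [Pi.sub_apply, this]
    rw [enorm_sub_rev]
    simp [RectangleTerm.eval, hy]
  · simp [RectangleTerm.eval, hy]

theorem comap_pi_sup_eq_generateFrom (ℓ : H → Y → ℝ) (B : MeasurableSpace Y) :
    MeasurableSpace.comap (fun y h => ℓ h y) MeasurableSpace.pi ⊔ B =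
      MeasurableSpace.generateFrom {s | ∃ C ∈ measurableCylinders fun _ : H => ℝ,
        ∃ b, MeasurableSet[B] b ∧ s = (fun y h => ℓ h y) ⁻¹' C ∩ b} := by
  apply le_antisymm
  · refine sup_le ?_ ?_
    · rw [← generateFrom_measurableCylinders, MeasurableSpace.comap_generateFrom]
      refine MeasurableSpace.generateFrom_le ?_
      rintro _ ⟨C, hC, rfl⟩
      exact MeasurableSpace.measurableSet_generateFrom
        ⟨C, hC, Set.univ, MeasurableSet.univ, (Set.inter_univ _).symm⟩
    · exact fun b hb => MeasurableSpace.measurableSet_generateFrom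
        ⟨Set.univ, univ_mem_measurableCylinders _, b, hb, (Set.univ_inter _).symm⟩
  · refine MeasurableSpace.generateFrom_le ?_
    rintro _ ⟨C, hC, b, hb, rfl⟩
    refine MeasurableSet.inter ?_ ((le_sup_right : B ≤ _ ⊔ B) b hb)
    refine (le_sup_left : _ ≤ _ ⊔ B) _ ⟨C, ?_, rfl⟩
    rw [← generateFrom_measurableCylinders]
    exact MeasurableSpace.measurableSet_generateFrom hC

theorem isApproxByRectangles_of_measurableSet [IsFiniteMeasure μ] (hB : B ≤ mY)
    (hℓ : ∀ h, Measurable (ℓ h))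
    (hY : mY ≤ eventuallyMeasurableSpace
      (MeasurableSpace.comap (fun y h => ℓ h y) MeasurableSpace.pi ⊔ B) (ae μ))
    {A : Set Y} (hA : MeasurableSet A) : IsApproxByRectangles μ ℓ B A := by
  have hLm : Measurable fun y h => ℓ h y := measurable_pi_lambda _ hℓ
  have hle : MeasurableSpace.comap (fun y h => ℓ h y) MeasurableSpace.pi ⊔ B ≤ mY :=
    sup_le hLm.comap_le hB
  obtain ⟨A', hA', hAA'⟩ := hY A hA
  refine .of_symmDiff hB hℓ hA fun ε _ => ⟨A', hle A' hA', ?_, ?_⟩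
  swap
  · rw [measure_symmDiff_eq_zero_iff.2 hAA'.symm]
    exact zero_le
  clear hAA'
  induction A', hA' using MeasurableSpace.induction_on_inter
    (comap_pi_sup_eq_generateFrom ℓ B) with
  | h_inter =>
    rintro _ ⟨C, hC, b, hb, rfl⟩ _ ⟨C', hC', b', hb', rfl⟩ -
    exact ⟨C ∩ C', inter_mem_measurableCylinders hC hC', b ∩ b', hb.inter hb', by
      rw [Set.preimage_inter, Set.inter_inter_inter_comm]⟩
  | empty => exact fun ε _ => ⟨0, Submodule.zero_mem _, by simp⟩
  | basic s hs =>
    obtain ⟨C, hC, b, hb, rfl⟩ := hs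
    exact isApproxByRectangles_cylinder_inter hℓ hC hb
  | compl s _ ih => exact ih.compl
  | iUnion s hd hs ih => exact .iUnion hB hℓ (fun i => hle _ (hs i)) hd ih

/-- If the variables `ℓ h` together with `B` generate the ambient σ-field up to null sets, then
finite sums of rectangle terms are dense in `L¹`. -/
theorem exists_sum_rectangleTerm_integral_abs_sub_le [IsFiniteMeasure μ] (hB : B ≤ mY)
    (hℓ : ∀ h, Measurable (ℓ h))
    (hY : mY ≤ eventuallyMeasurableSpace
      (MeasurableSpace.comap (fun y h => ℓ h y) MeasurableSpace.pi ⊔ B) (ae μ))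
    {f : Y → ℝ} (hf : Integrable f μ) {ε : ℝ} (hε : 0 < ε) :
    ∃ (n : ℕ) (c : Fin n → RectangleTerm H B),
      ∫ y, |f y - ∑ k, (c k).eval ℓ y| ∂μ ≤ ε := by
  obtain ⟨g, hfg, hg⟩ := (memLp_one_iff_integrable.2 hf).induction_dense ENNReal.one_ne_top
    (fun g => g ∈ rectangleSpan ℓ B) (fun a A hA _ δ hδ => by
      obtain ⟨g, hg, hle⟩ := isApproxByRectangles_of_measurableSet hB hℓ hY hA (δ / ‖a‖ₑ)
        (ENNReal.div_ne_zero.2 ⟨hδ, enorm_ne_top⟩)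
      refine ⟨a • g, ?_, Submodule.smul_mem _ a hg⟩
      have : (a • g - A.indicator fun _ => a) = a • (g - A.indicator fun _ => (1 : ℝ)) := by
        ext y
        by_cases hy : y ∈ A <;> simp [hy, mul_sub]
      rw [this, eLpNorm_const_smul]
      exact (mul_le_mul_right hle _).trans ENNReal.mul_div_le)
    (fun f g hf hg => Submodule.add_mem _ hf hg)
    (fun f hf => (measurable_of_mem_rectangleSpan hB hℓ hf).aestronglyMeasurable)
    (ε := ENNReal.ofReal ε) (by simpa using hε)
  obtain ⟨n, a, s, hs⟩ := Submodule.mem_span_set'.1 hg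
  choose c hc using fun k => (s k).2
  refine ⟨n, fun k => ⟨(c k).coords, a k • (c k).weight, (c k).event, (c k).measurableSet_event⟩,
    ?_⟩
  have hsum : ∀ y, ∑ k, RectangleTerm.eval ℓ ⟨(c k).coords, a k • (c k).weight, (c k).event,
      (c k).measurableSet_event⟩ y = g y := by
    intro y
    rw [← hs, Finset.sum_apply]
    refine Finset.sum_congr rfl fun k _ => ?_
    rw [← hc k]
    simp [RectangleTerm.eval, mul_assoc]
  simp only [hsum]
  have hm : AEStronglyMeasurable (f - g) μ := hf.aestronglyMeasurable.sub
    (measurable_of_mem_rectangleSpan hB hℓ hg).aestronglyMeasurable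
  rw [eLpNorm_one_eq_lintegral_enorm] at hfg
  calc ∫ y, |f y - g y| ∂μ = (∫⁻ y, ‖(f - g) y‖ₑ ∂μ).toReal :=
        integral_norm_eq_lintegral_enorm hm
    _ ≤ ε := ENNReal.toReal_le_of_le_ofReal hε.le hfg

end Density

/-! ### Approximation and convergence in distribution -/

section ConvergenceInDistribution

variable {X : ℕ → Type*} {mX : ∀ n, MeasurableSpace (X n)} {μ : ∀ n, Measure (X n)}
  [∀ n, IsProbabilityMeasure (μ n)] {Y : Type*} {mY : MeasurableSpace Y} {ν : Measure Y}
  [IsProbabilityMeasure ν]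

theorem tendsto_integral_of_tendstoInDistribution {E : Type*} [TopologicalSpace E]
    [MeasurableSpace E] [OpensMeasurableSpace E] {U : ∀ n, X n → E} {V : Y → E}
    (h : TendstoInDistribution U atTop V μ ν) (F : E →ᵇ ℝ) :
    Tendsto (fun n => ∫ x, F (U n x) ∂(μ n)) atTop (𝓝 (∫ y, F (V y) ∂ν)) := by
  have := (ProbabilityMeasure.tendsto_iff_forall_integral_tendsto.1 h.tendsto) F
  have hF := F.continuous.measurable
  simp only [ProbabilityMeasure.coe_mk] at this
  rw [integral_map h.aemeasurable_limit hF.aestronglyMeasurable] at this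
  refine this.congr fun n => ?_
  rw [integral_map (h.forall_aemeasurable n) hF.aestronglyMeasurable]

theorem integrable_boundedContinuous_comp {Ω E : Type*} {mΩ : MeasurableSpace Ω}
    {ρ : Measure Ω} [IsFiniteMeasure ρ] [TopologicalSpace E] [MeasurableSpace E]
    [OpensMeasurableSpace E] {W : Ω → E} (hW : AEMeasurable W ρ) (F : E →ᵇ ℝ) :
    Integrable (fun ω => F (W ω)) ρ :=
  Integrable.of_bound (F.continuous.measurable.comp_aemeasurable hW).aestronglyMeasurable ‖F‖
    (.of_forall fun _ => F.norm_coe_le_norm _)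

theorem abs_integral_sub_integral_le_of_lipschitzWith {ι : Type*} [Fintype ι]
    {Ω : Type*} {mΩ : MeasurableSpace Ω} {ρ : Measure Ω} [IsProbabilityMeasure ρ]
    {f : (ι → ℝ) → ℝ} {C : ℝ} (hC : ∀ x y, dist (f x) (f y) ≤ C) {K : NNReal}
    (hK : LipschitzWith K f) {U V : Ω → ι → ℝ} (hU : ∀ i, Integrable (fun ω => U ω i) ρ)
    (hV : ∀ i, Integrable (fun ω => V ω i) ρ) :
    |∫ ω, f (U ω) ∂ρ - ∫ ω, f (V ω) ∂ρ| ≤ K * ∑ i, ∫ ω, |U ω i - V ω i| ∂ρ := by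
  have hb : ∀ x, ‖f x‖ ≤ C + ‖f 0‖ := fun x => by
    have h1 := hC x 0
    rw [Real.dist_eq] at h1
    have h2 := abs_sub_abs_le_abs_sub (f x) (f 0)
    simp only [Real.norm_eq_abs]
    linarith
  have hint : ∀ W : Ω → ι → ℝ, (∀ i, Integrable (fun ω => W ω i) ρ) →
      Integrable (fun ω => f (W ω)) ρ := fun W hW =>
    Integrable.of_bound (hK.continuous.measurable.comp_aemeasurable
      (aemeasurable_pi_lambda _ fun i => (hW i).aemeasurable)).aestronglyMeasurable _
      (.of_forall fun ω => hb _)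
  have hd : ∀ i, Integrable (fun ω => |U ω i - V ω i|) ρ := fun i => ((hU i).sub (hV i)).abs
  rw [← integral_sub (hint U hU) (hint V hV), ← integral_finsetSum _ fun i _ => hd i,
    ← integral_const_mul]
  refine (abs_integral_le_integral_abs).trans (integral_mono ((hint U hU).sub (hint V hV)).abs
    ((integrable_finsetSum _ fun i _ => hd i).const_mul _) fun ω => ?_)
  have h1 := hK.dist_le_mul (U ω) (V ω)
  rw [Real.dist_eq] at h1
  refine h1.trans (mul_le_mul_of_nonneg_left ?_ K.2)
  rw [dist_pi_le_iff (Finset.sum_nonneg fun i _ => abs_nonneg _)]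
  intro i
  rw [Real.dist_eq]
  exact Finset.single_le_sum (f := fun i => |U ω i - V ω i|) (fun i _ => abs_nonneg _)
    (Finset.mem_univ i)

/-- Convergence in distribution follows if the random vectors and their limit can be replaced, up
to arbitrarily small `L¹`-errors, by random vectors that converge in distribution. -/
theorem tendstoInDistribution_of_forall_exists_approx {ι : Type*} [Fintype ι]
    {U : ∀ n, X n → ι → ℝ} {V : Y → ι → ℝ} (hU : ∀ n i, Integrable (fun x => U n x i) (μ n))
    (hV : ∀ i, Integrable (fun y => V y i) ν)
    (h : ∀ ε : ℝ, 0 < ε → ∃ (U' : ∀ n, X n → ι → ℝ) (V' : Y → ι → ℝ),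
      (∀ n i, Integrable (fun x => U' n x i) (μ n)) ∧ (∀ i, Integrable (fun y => V' y i) ν) ∧
      TendstoInDistribution U' atTop V' μ ν ∧
      (∀ i, ∀ᶠ n in atTop, ∫ x, |U n x i - U' n x i| ∂(μ n) ≤ ε) ∧
      ∀ i, ∫ y, |V y i - V' y i| ∂ν ≤ ε) :
    TendstoInDistribution U atTop V μ ν := by
  have hUm : ∀ n, AEMeasurable (U n) (μ n) := fun n =>
    aemeasurable_pi_lambda _ fun i => (hU n i).aemeasurable
  have hVm : AEMeasurable V ν := aemeasurable_pi_lambda _ fun i => (hV i).aemeasurable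
  refine ⟨hUm, hVm, tendsto_iff_forall_lipschitz_integral_tendsto.2 ?_⟩
  rintro f ⟨C, hC⟩ ⟨K, hK⟩
  simp only [ProbabilityMeasure.coe_mk]
  rw [integral_map hVm hK.continuous.measurable.aestronglyMeasurable]
  simp only [fun n => integral_map (hUm n) hK.continuous.measurable.aestronglyMeasurable]
  rw [Metric.tendsto_atTop']
  intro δ hδ
  set N : ℝ := K * Fintype.card ι with hN
  have hN0 : 0 ≤ N := by positivity
  obtain ⟨U', V', hU', hV', hconv, hUU', hVV'⟩ := h (δ / (3 * (N + 1))) (by positivity)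
  set ε := δ / (3 * (N + 1)) with hε
  have hNε : N * ε < δ / 3 := by
    rw [hε, mul_div_assoc', div_lt_div_iff₀ (by positivity) (by norm_num)]
    nlinarith
  have hbound : ∀ a : ι → ℝ, (∀ i, a i ≤ ε) → K * ∑ i, a i ≤ N * ε := fun a ha => by
    have : ∑ i, a i ≤ Fintype.card ι * ε := by
      simpa using Finset.sum_le_sum fun i (_ : i ∈ Finset.univ) => ha i
    calc (K : ℝ) * ∑ i, a i ≤ K * (Fintype.card ι * ε) := mul_le_mul_of_nonneg_left this K.2
      _ = N * ε := by rw [hN]; ring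
  let F : (ι → ℝ) →ᵇ ℝ := ⟨⟨f, hK.continuous⟩, C, hC⟩
  have h1 : Tendsto (fun n => ∫ x, f (U' n x) ∂(μ n)) atTop (𝓝 (∫ y, f (V' y) ∂ν)) :=
    tendsto_integral_of_tendstoInDistribution hconv F
  have h2 := Metric.tendsto_nhds.1 h1 (δ / 3) (by positivity)
  have h3 : ∀ᶠ n in atTop, ∀ i, ∫ x, |U n x i - U' n x i| ∂(μ n) ≤ ε :=
    eventually_all.2 hUU'
  obtain ⟨n₀, hn₀⟩ := eventually_atTop.1 (h2.and h3)
  refine ⟨n₀, fun n hn => ?_⟩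
  obtain ⟨h4, h5⟩ := hn₀ n hn.le
  have h6 := (abs_integral_sub_integral_le_of_lipschitzWith hC hK (hU n) (hU' n)).trans
    (hbound _ h5)
  have h7 := (abs_integral_sub_integral_le_of_lipschitzWith hC hK hV hV').trans (hbound _ hVV')
  rw [Real.dist_eq] at h4 ⊢
  rw [abs_lt] at h4 ⊢
  rw [abs_le] at h6 h7
  constructor <;> linarith [h4.1, h4.2, h6.1, h6.2, h7.1, h7.2]

/-- A Scheffé-type argument: for nonnegative variables of mass at most one whose weak limit has
mass one, `L¹`-distances to bounded continuous functions do not increase in the limit. It takes the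
place of uniform integrability and rests on `|a - b| = 2 (b - a)⁺ + a - b`, where `(b - a)⁺` is
bounded if `0 ≤ a` and `b` is bounded. -/
theorem eventually_integral_abs_sub_le_of_tendstoInDistribution {E : Type*} [TopologicalSpace E]
    [MeasurableSpace E] [OpensMeasurableSpace E] {U : ∀ n, X n → E} {V : Y → E}
    (h : TendstoInDistribution U atTop V μ ν) (G : E →ᵇ ℝ) {a : E → ℝ} (ha : Continuous a)
    (hU0 : ∀ n x, 0 ≤ a (U n x)) (hV0 : ∀ y, 0 ≤ a (V y))
    (hUint : ∀ n, Integrable (fun x => a (U n x)) (μ n)) (hVint : Integrable (fun y => a (V y)) ν)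
    (hU1 : ∀ n, ∫ x, a (U n x) ∂(μ n) ≤ 1) (hV1 : ∫ y, a (V y) ∂ν = 1) {δ : ℝ}
    (hδ : ∫ y, |a (V y) - G (V y)| ∂ν < δ) :
    ∀ᶠ n in atTop, ∫ x, |a (U n x) - G (U n x)| ∂(μ n) ≤ δ := by
  have hΦ : ∀ e, 0 ≤ max (G e - max (a e) 0) 0 ∧ max (G e - max (a e) 0) 0 ≤ ‖G‖ := fun e => by
    have h1 := (abs_le.1 (G.norm_coe_le_norm e)).2
    exact ⟨le_max_right _ _, max_le (by linarith [le_max_right (a e) 0]) (norm_nonneg G)⟩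
  let Φ : E →ᵇ ℝ := BoundedContinuousFunction.ofNormedAddCommGroup
    (fun e => max (G e - max (a e) 0) 0) (by fun_prop) ‖G‖ fun e => by
      rw [Real.norm_eq_abs, abs_of_nonneg (hΦ e).1]
      exact (hΦ e).2
  have hpt : ∀ e, 0 ≤ a e → |a e - G e| = 2 * Φ e + a e - G e := fun e he => by
    have : Φ e = max (G e - a e) 0 := by
      change max (G e - max (a e) 0) 0 = _
      rw [max_eq_left he]
    rw [this]
    rcases le_total (G e) (a e) with h' | h'
    · rw [abs_of_nonneg (by linarith), max_eq_right (by linarith)]; ring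
    · rw [abs_of_nonpos (by linarith), max_eq_left (by linarith)]; ring
  have hU2 : ∀ n, ∫ x, |a (U n x) - G (U n x)| ∂(μ n)
      ≤ 2 * ∫ x, Φ (U n x) ∂(μ n) + 1 - ∫ x, G (U n x) ∂(μ n) := fun n => by
    have i1 := (integrable_boundedContinuous_comp (h.forall_aemeasurable n) Φ).const_mul 2
    have i2 := integrable_boundedContinuous_comp (h.forall_aemeasurable n) G
    simp only [fun x => hpt _ (hU0 n x)]
    rw [integral_sub (f := fun x => 2 * Φ (U n x) + a (U n x)) (i1.add (hUint n)) i2,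
      integral_add i1 (hUint n), integral_const_mul]
    linarith [hU1 n]
  have hV2 : ∫ y, |a (V y) - G (V y)| ∂ν
      = 2 * ∫ y, Φ (V y) ∂ν + 1 - ∫ y, G (V y) ∂ν := by
    have i1 := (integrable_boundedContinuous_comp h.aemeasurable_limit Φ).const_mul 2
    have i2 := integrable_boundedContinuous_comp h.aemeasurable_limit G
    simp only [fun y => hpt _ (hV0 y)]
    rw [integral_sub (f := fun y => 2 * Φ (V y) + a (V y)) (i1.add hVint) i2,
      integral_add i1 hVint, integral_const_mul, hV1]
  have hlim := (((tendsto_integral_of_tendstoInDistribution h Φ).const_mul 2).add_const 1).sub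
    (tendsto_integral_of_tendstoInDistribution h G)
  rw [← hV2] at hlim
  exact (hlim.eventually_lt_const hδ).mono fun n hn => (hU2 n).trans hn.le

end ConvergenceInDistribution

/-! ### Conditional expectations of sums of products; encoding of events -/

section Projection

/-- Compares the conditional expectation of `f` with `∑ cₖ gₖ`, when `f` is close to a sum of
products `φₖ gₖ` with `gₖ` measurable with respect to the conditioning σ-field and `φₖ` having a
constant conditional expectation close to `cₖ`. -/
theorem integral_abs_condExp_sub_sum_le {Ω κ : Type*} [Fintype κ] {m mΩ : MeasurableSpace Ω}
    {ρ : Measure Ω} [IsProbabilityMeasure ρ] (hm : m ≤ mΩ) {f : Ω → ℝ} (hf : Integrable f ρ)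
    {φ g : κ → Ω → ℝ} {C : κ → ℝ} (c : κ → ℝ) (hφ : ∀ k, Integrable (φ k) ρ)
    (hφm : ∀ k, ρ[φ k | m] =ᵐ[ρ] fun _ => ∫ ω, φ k ω ∂ρ)
    (hg : ∀ k, Measurable[m] (g k)) (hC : ∀ k ω, |g k ω| ≤ C k) :
    ∫ ω, |(ρ[f | m]) ω - ∑ k, c k * g k ω| ∂ρ
      ≤ ∫ ω, |f ω - ∑ k, φ k ω * g k ω| ∂ρ + ∑ k, |(∫ ω, φ k ω ∂ρ) - c k| * C k := by
  have hprod : ∀ k, Integrable (φ k * g k) ρ := fun k =>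
    (hφ k).mul_bdd (c := C k) ((hg k).mono hm le_rfl).aestronglyMeasurable (.of_forall (hC k))
  have hgint : ∀ k, Integrable (g k) ρ := fun k =>
    Integrable.of_bound ((hg k).mono hm le_rfl).aestronglyMeasurable (C k) (.of_forall (hC k))
  have hsum : Integrable (∑ k, φ k * g k) ρ := integrable_finsetSum' _ fun k _ => hprod k
  have h1 : ρ[∑ k, φ k * g k | m] =ᵐ[ρ] fun ω => ∑ k, (∫ ω, φ k ω ∂ρ) * g k ω := by
    refine (condExp_finsetSum (fun k _ => hprod k) m).trans ?_
    have : ∀ᵐ ω ∂ρ, ∀ k, (ρ[φ k * g k | m]) ω = (∫ ω, φ k ω ∂ρ) * g k ω := by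
      refine ae_all_iff.2 fun k => ?_
      filter_upwards [condExp_mul_of_stronglyMeasurable_right (hg k).stronglyMeasurable (hprod k)
        (hφ k), hφm k] with ω h1 h2
      rw [h1, Pi.mul_apply, h2]
    filter_upwards [this] with ω hω
    simp only [Finset.sum_apply, hω]
  have h2 := integral_abs_condExp_le (m := m) (μ := ρ) (f - ∑ k, φ k * g k)
  have h3 : ∀ᵐ ω ∂ρ, |(ρ[f | m]) ω - ∑ k, c k * g k ω|
      ≤ |(ρ[f - ∑ k, φ k * g k | m]) ω| + ∑ k, |(∫ ω, φ k ω ∂ρ) - c k| * C k := by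
    filter_upwards [h1, condExp_sub hf hsum m] with ω a1 a2
    rw [a2, Pi.sub_apply, a1]
    have e : (ρ[f | m]) ω - ∑ k, c k * g k ω
        = ((ρ[f | m]) ω - ∑ k, (∫ ω, φ k ω ∂ρ) * g k ω)
          + ∑ k, ((∫ ω, φ k ω ∂ρ) - c k) * g k ω := by
      simp only [sub_mul, Finset.sum_sub_distrib]; ring
    rw [e]
    refine (abs_add_le _ _).trans (add_le_add_right ?_ _)
    refine (Finset.abs_sum_le_sum_abs _ _).trans (Finset.sum_le_sum fun k _ => ?_)
    rw [abs_mul]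
    exact mul_le_mul_of_nonneg_left (hC k ω) (abs_nonneg _)
  have h4 : Integrable (fun ω => |(ρ[f | m]) ω - ∑ k, c k * g k ω|) ρ :=
    (integrable_condExp.sub (integrable_finsetSum _ fun k _ => (hgint k).const_mul _)).abs
  refine (integral_mono_ae h4 (integrable_condExp.abs.add (integrable_const _)) h3).trans ?_
  rw [integral_add' integrable_condExp.abs (integrable_const _)]
  simp only [integral_const, probReal_univ, one_smul]
  refine add_le_add_left (h2.trans_eq ?_) _
  simp

/-- Finitely many events of a σ-field are encoded by a single real variable, in such a way that
their indicators are bounded continuous functions of that variable. -/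
theorem exists_measurable_encoding {Y κ : Type*} [Finite κ] {B : MeasurableSpace Y}
    {A : κ → Set Y} (hA : ∀ k, MeasurableSet (A k)) :
    ∃ ξ : Y → ℝ, Measurable ξ ∧ ∃ g : κ → ℝ →ᵇ ℝ,
      ∀ k y, g k (ξ y) = (A k).indicator (fun _ => 1) y := by
  classical
  obtain ⟨N, ⟨e⟩⟩ := Finite.exists_equiv_fin (κ → Bool)
  -- The finite space `κ → Bool` embeds into `ℝ` as a closed set, and functions on its image extend
  -- by Tietze's theorem.
  let c : (κ → Bool) → ℝ := fun b => (e b : ℕ)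
  have hc : Function.Injective c := fun b b' h =>
    e.injective (Fin.ext (Nat.cast_injective (R := ℝ) h))
  have hemb : Topology.IsClosedEmbedding c :=
    (continuous_of_discreteTopology).isClosedEmbedding hc
  let u : Y → κ → Bool := fun y k => decide (y ∈ A k)
  have hu : Measurable u := measurable_pi_lambda _ fun k => measurable_to_bool (by
    convert hA k
    ext y
    simp [u])
  refine ⟨fun y => c (u y), (measurable_from_top (f := c)).comp ?_, ?_⟩
  · intro s _
    exact hu (Set.toFinite s).measurableSet
  choose g _ hg using fun k => BoundedContinuousFunction.exists_extension_norm_eq_of_isClosedEmbedding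
    (BoundedContinuousFunction.mkOfCompact
      ⟨fun b : κ → Bool => if b k then (1 : ℝ) else 0, continuous_of_discreteTopology⟩) hemb
  refine ⟨g, fun k y => ?_⟩
  have := congrFun (hg k) (u y)
  simp only [Function.comp_apply] at this
  rw [this]
  simp [u, Set.indicator_apply]

end Projection

/-! ### Likelihood ratios of the nuisance subexperiment -/

section Likelihood

variable {Ω Θ Υ : Type*} {m B mΩ : MeasurableSpace Ω}

theorem measurable_likelihoodRatio {T : Type*} [Zero T] (P : T → Measure Ω) (t : T) :
    Measurable (likelihoodRatio P t) :=
  (Measure.measurable_rnDeriv _ _).ennreal_toReal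

theorem integrable_likelihoodRatio {T : Type*} [Zero T] (P : T → Measure Ω)
    [∀ t, IsProbabilityMeasure (P t)] (t : T) : Integrable (likelihoodRatio P t) (P 0) :=
  Measure.integrable_toReal_rnDeriv

theorem integral_likelihoodRatio_le_one {T : Type*} [Zero T] (P : T → Measure Ω)
    [∀ t, IsProbabilityMeasure (P t)] (t : T) : ∫ ω, likelihoodRatio P t ω ∂(P 0) ≤ 1 := by
  have := Measure.setIntegral_toReal_rnDeriv_le (μ := P t) (ν := P 0) (s := Set.univ)
    (measure_ne_top _ _)
  simpa [likelihoodRatio] using this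

theorem integral_likelihoodRatio_eq_one {T : Type*} [Zero T] (P : T → Measure Ω)
    [∀ t, IsProbabilityMeasure (P t)] {t : T} (h : P t ≪ P 0) :
    ∫ ω, likelihoodRatio P t ω ∂(P 0) = 1 := by
  have := Measure.integral_toReal_rnDeriv h
  rwa [probReal_univ] at this

variable [Zero Θ] [Zero Υ] {P : Θ × Υ → Measure Ω} [∀ t, IsProbabilityMeasure (P t)]

instance isProbabilityMeasure_nuisance (η : Υ) : IsProbabilityMeasure (nuisance P η) :=
  inferInstanceAs (IsProbabilityMeasure (P (0, η)))

/-- Under the base measure, the nuisance likelihood ratios are independent of the ancillary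
σ-field: they are measurable with respect to the sufficient one, to which Basu's theorem
applies. -/
theorem condExp_nuisance_likelihoodRatio (hs : IsSufficient (nuisance P) m)
    (hc : IsBoundedlyComplete (nuisance P) m) (hB : IsAncillary (nuisance P) B) {J : Finset Υ}
    (φ : (J → ℝ) →ᵇ ℝ) :
    (P 0)[fun ω => φ fun j => likelihoodRatio P (0, (j : Υ)) ω | B] =ᵐ[P 0]
      fun _ => ∫ ω, φ (fun j => likelihoodRatio P (0, (j : Υ)) ω) ∂(P 0) := by
  refine condExp_eq_const_of_indep hs.1 hB.1 ?_ (hs.indep_of_isAncillary hc hB 0)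
  choose f hfm hf using fun j : J => hs.exists_measurable_ae_eq_rnDeriv 0 (j : Υ)
  have hφm : Measurable[m] fun ω => φ fun j => f j ω :=
    φ.continuous.measurable.comp (@measurable_pi_lambda _ _ _ m _ _ hfm)
  refine ⟨fun ω => φ fun j => f j ω, hφm.stronglyMeasurable, ?_⟩
  filter_upwards [ae_all_iff.2 hf] with ω hω
  exact congrArg φ (funext hω)

/-- By minimal sufficiency, the nuisance likelihood ratios generate the sufficient σ-field up to
null sets; hence together with `B` they generate everything. -/
theorem le_eventuallyMeasurableSpace_likelihoodRatio (hac : ∀ t, P t ≪ P 0)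
    (hs : IsMinimalSufficient (nuisance P) m) (hm : m ⊔ B = mΩ) :
    mΩ ≤ eventuallyMeasurableSpace (MeasurableSpace.comap
      (fun ω (η : Υ) => likelihoodRatio P (0, η) ω) MeasurableSpace.pi ⊔ B) (ae (P 0)) := by
  refine hm.symm.le.trans (sup_le (fun s hsm => ?_) (le_sup_right.trans
    le_eventuallyMeasurableSpace))
  obtain ⟨s', hs', h0⟩ := hs.2 _ (isSufficient_comap_rnDeriv (P := nuisance P) (0 : Υ)
    fun η => hac (0, η)) s hsm
  exact ⟨s', (le_sup_left : _ ≤ _ ⊔ B) s' hs', measure_symmDiff_eq_zero_iff.1 (h0 0)⟩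

end Likelihood

/-! ### Approximation of projected likelihood ratios -/

section Approximation

variable {Θ Υ : Type*} [Zero Θ] [Zero Υ]

/-- If, in the limit, a likelihood ratio is within `δ` of a sum of products of continuous functions
of nuisance likelihood ratios and bounded continuous functions of a variable `ξ`, then this
persists asymptotically along any `ξs` converging to `ξ` jointly with the likelihood ratios.
Conditioning on ancillary σ-fields for which the `ξs` are measurable averages out the nuisance
likelihood ratios, and their means converge. -/
theorem eventually_integral_abs_condExp_likelihoodRatio_sub_le
    {X : ℕ → Type*} {mX : ∀ n, MeasurableSpace (X n)}
    {P : ∀ n, Θ × Υ → Measure (X n)} [∀ n t, IsProbabilityMeasure (P n t)]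
    {Y : Type*} {mY : MeasurableSpace Y}
    {Q : Θ × Υ → Measure Y} [∀ t, IsProbabilityMeasure (Q t)]
    (hLeCam : LeCamConverges P Q) {Sn Bn : ∀ n, MeasurableSpace (X n)}
    (hs : ∀ n, IsSufficient (nuisance (P n)) (Sn n))
    (hc : ∀ n, IsBoundedlyComplete (nuisance (P n)) (Sn n))
    (hB : ∀ n, IsAncillary (nuisance (P n)) (Bn n))
    {ξs : ∀ n, X n → ℝ} (hξs : ∀ n, Measurable[Bn n] (ξs n)) {ξ : Y → ℝ}
    (hw : WeaklyConverges (mX := mX) P Q ξs ξ) {t : Θ × Υ} (ht : Q t ≪ Q 0)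
    {κ : Type*} [Fintype κ] {I : κ → Finset Υ} (w : ∀ k, (I k → ℝ) →ᵇ ℝ) (g : κ → ℝ →ᵇ ℝ)
    {δ ε : ℝ} (hδε : δ < ε)
    (hδ : ∫ y, |likelihoodRatio Q t y -
      ∑ k, w k (fun j => likelihoodRatio Q (0, (j : Υ)) y) * g k (ξ y)| ∂(Q 0) ≤ δ) :
    ∀ᶠ n in atTop, ∫ x, |((P n 0)[likelihoodRatio (P n) t | Bn n]) x -
      ∑ k, (∫ y, w k (fun j => likelihoodRatio Q (0, (j : Υ)) y) ∂(Q 0)) * g k (ξs n x)| ∂(P n 0)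
        ≤ ε := by
  classical
  -- All likelihood ratios involved, so that one joint weak limit covers them.
  let J : Finset (Θ × Υ) :=
    insert t (Finset.univ.biUnion fun k => (I k).image fun h => (0, h))
  have hmem : ∀ k, ∀ j : I k, ((0 : Θ), (j : Υ)) ∈ J := fun k j =>
    Finset.mem_insert_of_mem (Finset.mem_biUnion.2
      ⟨k, Finset.mem_univ k, Finset.mem_image_of_mem _ j.2⟩)
  let t₀ : J := ⟨t, Finset.mem_insert_self _ _⟩
  let φ : κ → (J → ℝ) →ᵇ ℝ := fun k => (w k).compContinuous
    ⟨fun l j => l ⟨(0, (j : Υ)), hmem k j⟩, by fun_prop⟩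
  let G : ((J → ℝ) × ℝ) →ᵇ ℝ := ∑ k, (φ k).compContinuous ⟨Prod.fst, continuous_fst⟩ *
    (g k).compContinuous ⟨Prod.snd, continuous_snd⟩
  have hG : ∀ p, G p = ∑ k, φ k p.1 * g k p.2 := fun p => by
    simp [G, BoundedContinuousFunction.coe_sum]
  have hlim : ∀ᶠ n in atTop, ∫ x, |likelihoodRatio (P n) t x -
      ∑ k, φ k (fun t : J => likelihoodRatio (P n) t x) * g k (ξs n x)| ∂(P n 0)
        ≤ (δ + ε) / 2 := by
    have := eventually_integral_abs_sub_le_of_tendstoInDistribution (hw J) G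
      (a := fun p => p.1 t₀) (by fun_prop) (fun n x => ENNReal.toReal_nonneg)
      (fun y => ENNReal.toReal_nonneg) (fun n => integrable_likelihoodRatio (P n) t)
      (integrable_likelihoodRatio Q t) (fun n => integral_likelihoodRatio_le_one (P n) t)
      (integral_likelihoodRatio_eq_one Q ht) (δ := (δ + ε) / 2) (by
        simp only [hG]
        exact hδ.trans_lt (by linarith))
    simpa only [hG] using this
  have hcoef : Tendsto (fun n => ∑ k, |∫ x, φ k (fun t : J => likelihoodRatio (P n) t x) ∂(P n 0) -
      ∫ y, w k (fun j => likelihoodRatio Q (0, (j : Υ)) y) ∂(Q 0)| * ‖g k‖) atTop (𝓝 0) := by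
    rw [show (0 : ℝ) = ∑ k, |∫ y, w k (fun j => likelihoodRatio Q (0, (j : Υ)) y) ∂(Q 0) -
      ∫ y, w k (fun j => likelihoodRatio Q (0, (j : Υ)) y) ∂(Q 0)| * ‖g k‖ by simp]
    exact tendsto_finsetSum _ fun k _ => (((tendsto_integral_of_tendstoInDistribution
      (hLeCam J) (φ k)).sub_const _).abs).mul_const _
  filter_upwards [hlim,
    hcoef.eventually_le_const (show 0 < (ε - δ) / 2 by linarith)] with n h1 h2
  have hLm : Measurable[mX n] fun x (t : J) => likelihoodRatio (P n) t x :=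
    @measurable_pi_lambda _ _ _ (mX n) _ _ fun t => measurable_likelihoodRatio (P n) _
  have := integral_abs_condExp_sub_sum_le (hB n).1 (integrable_likelihoodRatio (P n) t)
    (fun k => ∫ y, w k (fun j => likelihoodRatio Q (0, (j : Υ)) y) ∂(Q 0))
    (fun k => integrable_boundedContinuous_comp hLm.aemeasurable (φ k))
    (fun k => condExp_nuisance_likelihoodRatio (hs n) (hc n) (hB n) (w k))
    (fun k => (g k).continuous.measurable.comp (hξs n)) (fun k x => (g k).norm_coe_le_norm _)
  exact this.trans ((add_le_add h1 h2).trans (by linarith))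

theorem integral_abs_condExp_likelihoodRatio_sub_le {Ω : Type*} {m B mΩ : MeasurableSpace Ω}
    {Q : Θ × Υ → Measure Ω} [∀ t, IsProbabilityMeasure (Q t)]
    (hs : IsSufficient (nuisance Q) m) (hc : IsBoundedlyComplete (nuisance Q) m)
    (hB : IsAncillary (nuisance Q) B) {ξ : Ω → ℝ} (hξ : Measurable[B] ξ) {t : Θ × Υ}
    {κ : Type*} [Fintype κ] {I : κ → Finset Υ} (w : ∀ k, (I k → ℝ) →ᵇ ℝ) (g : κ → ℝ →ᵇ ℝ)
    {δ : ℝ} (hδ : ∫ y, |likelihoodRatio Q t y -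
      ∑ k, w k (fun j => likelihoodRatio Q (0, (j : Υ)) y) * g k (ξ y)| ∂(Q 0) ≤ δ) :
    ∫ y, |((Q 0)[likelihoodRatio Q t | B]) y -
      ∑ k, (∫ y, w k (fun j => likelihoodRatio Q (0, (j : Υ)) y) ∂(Q 0)) * g k (ξ y)| ∂(Q 0)
        ≤ δ := by
  have hLm : ∀ k, Measurable fun y (j : I k) => likelihoodRatio Q (0, (j : Υ)) y := fun k =>
    measurable_pi_lambda _ fun t => measurable_likelihoodRatio Q _
  have := integral_abs_condExp_sub_sum_le hB.1 (integrable_likelihoodRatio Q t)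
    (fun k => ∫ y, w k (fun j => likelihoodRatio Q (0, (j : Υ)) y) ∂(Q 0))
    (fun k => integrable_boundedContinuous_comp (hLm k).aemeasurable (w k))
    (fun k => condExp_nuisance_likelihoodRatio hs hc hB (w k))
    (fun k => (g k).continuous.measurable.comp hξ) (fun k x => (g k).norm_coe_le_norm _)
  simp only [sub_self, abs_zero, zero_mul, Finset.sum_const_zero, add_zero] at this
  exact this.trans hδ

end Approximation

end Ancillarity

/-! ### Convergence of the projected likelihood ratios -/

theorem mainTheorem1 {k : ℕ} {Υ : Type*} [AddCommGroup Υ] [Module ℝ Υ]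
    -- the local experiments and the limit experiment, with parameter `(τ, η)`
    {X : ℕ → Type*} {mX : ∀ n, MeasurableSpace (X n)}
    (P : ∀ n, EuclideanSpace ℝ (Fin k) × Υ → Measure (X n))
    [∀ n t, IsProbabilityMeasure (P n t)]
    {Y : Type*} {mY : MeasurableSpace Y}
    (Q : EuclideanSpace ℝ (Fin k) × Υ → Measure Y)
    [∀ t, IsProbabilityMeasure (Q t)]
    (hQ : ∀ t, Q t ≪ Q 0)
    (hLeCam : Ancillarity.LeCamConverges P Q)
    (hcg : MeasurableSpace.CountablyGenerated Y)
    -- (i) the limit nuisance subexperiment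
    (S B : MeasurableSpace Y)
    (hS_min : Ancillarity.IsMinimalSufficient (Ancillarity.nuisance Q) S)
    (hS_compl : Ancillarity.IsBoundedlyComplete (Ancillarity.nuisance Q) S)
    (hB_max : Ancillarity.IsMaximalAncillary (Ancillarity.nuisance Q) B)
    (hSB : S ⊔ B = mY)
    -- (ii) the nuisance subexperiments of the sequence
    (Sn Bn : ∀ n, MeasurableSpace (X n))
    (hSn_min : ∀ n, Ancillarity.IsMinimalSufficient (Ancillarity.nuisance (P n)) (Sn n))
    (hSn_compl : ∀ n, Ancillarity.IsBoundedlyComplete (Ancillarity.nuisance (P n)) (Sn n))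
    (hBn_max : ∀ n, Ancillarity.IsMaximalAncillary (Ancillarity.nuisance (P n)) (Bn n))
    -- (iii) weak convergence of the ancillary σ-fields
    (hconv : Ancillarity.SigmaFieldWeaklyConverges (mX := mX) P Q Bn B)
    (l₁ l₂ : ℕ) (τ : Fin l₁ → EuclideanSpace ℝ (Fin k)) (η : Fin l₂ → Υ) :
    TendstoInDistribution (m := mX)
      (fun n x (ij : Fin l₁ × Fin l₂) =>
        ((P n 0)[Ancillarity.likelihoodRatio (P n) (τ ij.1, η ij.2) | Bn n]) x)
      atTop
      (fun y (ij : Fin l₁ × Fin l₂) =>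
        ((Q 0)[Ancillarity.likelihoodRatio Q (τ ij.1, η ij.2) | B]) y)
      (fun n => P n 0) (Q 0) := by
  have hgen := Ancillarity.le_eventuallyMeasurableSpace_likelihoodRatio hQ hS_min hSB
  refine Ancillarity.tendstoInDistribution_of_forall_exists_approx
    (fun n ij => integrable_condExp) (fun ij => integrable_condExp) fun ε hε => ?_
  -- The limit likelihood ratios are `L¹`-close to sums of products of continuous functions of
  -- nuisance likelihood ratios and indicators of ancillary events.
  choose N c hc using fun ij : Fin l₁ × Fin l₂ =>
    Ancillarity.exists_sum_rectangleTerm_integral_abs_sub_le hB_max.1.1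
      (fun η => Ancillarity.measurable_likelihoodRatio Q (0, η)) hgen
      (Ancillarity.integrable_likelihoodRatio Q (τ ij.1, η ij.2)) (half_pos hε)
  -- Weak convergence of σ-fields concerns single variables, without joint convergence for several
  -- of them; hence all these events are encoded by one real variable.
  obtain ⟨ξ, hξ, g, hg⟩ := Ancillarity.exists_measurable_encoding (B := B)
    (κ := Σ ij : Fin l₁ × Fin l₂, Fin (N ij)) (A := fun k => (c k.1 k.2).event)
    fun k => (c k.1 k.2).measurableSet_event
  obtain ⟨ξs, hξs, hw⟩ := hconv ξ hξ
  have hξlim : TendstoInDistribution (m := mX) ξs atTop ξ (fun n => P n 0) (Q 0) :=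
    (hw ∅).continuous_comp continuous_snd
  let F : ℝ → Fin l₁ × Fin l₂ → ℝ := fun x ij => ∑ k,
    (∫ y, (c ij k).weight (fun j => Ancillarity.likelihoodRatio Q (0, (j : Υ)) y) ∂(Q 0)) *
      g ⟨ij, k⟩ x
  have hF : Continuous F := by fun_prop
  have happrox : ∀ ij : Fin l₁ × Fin l₂,
      ∫ y, |Ancillarity.likelihoodRatio Q (τ ij.1, η ij.2) y - ∑ k,
        (c ij k).weight (fun j => Ancillarity.likelihoodRatio Q (0, (j : Υ)) y) *
          g ⟨ij, k⟩ (ξ y)| ∂(Q 0) ≤ ε / 2 := fun ij => by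
    simp only [hg]
    exact hc ij
  refine ⟨fun n x => F (ξs n x), fun y => F (ξ y), fun n ij => ?_, fun ij => ?_,
    hξlim.continuous_comp hF, fun ij => ?_, fun ij => ?_⟩
  · exact integrable_finsetSum _ fun k _ => (Ancillarity.integrable_boundedContinuous_comp
      (hξlim.forall_aemeasurable n) _).const_mul _
  · exact integrable_finsetSum _ fun k _ => (Ancillarity.integrable_boundedContinuous_comp
      hξlim.aemeasurable_limit _).const_mul _
  · exact Ancillarity.eventually_integral_abs_condExp_likelihoodRatio_sub_le hLeCam
      (fun n => (hSn_min n).1) hSn_compl (fun n => (hBn_max n).1) hξs hw (hQ _)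
      (fun k => (c ij k).weight) (fun k => g ⟨ij, k⟩) (half_lt_self hε) (happrox ij)
  · exact (Ancillarity.integral_abs_condExp_likelihoodRatio_sub_le hS_min.1 hS_compl hB_max.1 hξ
      (fun k => (c ij k).weight) (fun k => g ⟨ij, k⟩) (happrox ij)).trans (half_le_self hε.le)
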